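/- **Theorem.** For each $k \ge 1$ let $G_k$ be a finite connected graph (parallel edges and self-edges are allowed) with a distinguished vertex $v_k$. For a vertex $x$ of $G_k$ let $\deg_*(x)$ be the number of edges incident to $x$ that are not self-edges. For oriented edges $e=\overrightarrow{xy}$ and $f=\overrightarrow{zw}$ of $G_k$ let the transfer impedance $M(e,f)$ be $\varphi(z)-\varphi(w)$, where $\varphi$ is the voltage function of a unit current with source $x$ and sink $y$ when every edge of $G_k$ is a one-ohm resistor. Let $\epsilon_k>0$ with $\epsilon_k\to 0$, and suppose that there is a constant $C$, not depending on $k$, such that for every $k$ and all edges $e,f$ of $G_k$ incident to $v_k$ that are not self-edges, both oriented away from $v_k$, $$\Bigl|M(e,f)-\sum_{x\in e\cap f}\deg_*(x)^{-1}\Bigr|\le C\,\epsilon_k\sum_{x\in e}\deg_*(x)^{-1},$$ where $x\in e$ means that the vertex $x$ is an endpoint of $e$, and $e \cap f$ is the set of common endpoints. Suppose moreover that for some $\lambda>0$ $$\sum_{w\sim v_k}\frac1{\deg_*(w)}\longrightarrow\lambda\qquad(k\to\infty),$$ where the sum is over the neighbors $w\neq v_k$ of $v_k$, each counted as many times as there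 are edges joining it to $v_k$. Let $1+D_k$ be the degree of $v_k$ in a uniform random spanning tree of $G_k$. Then $D_k$ converges in distribution, as $k\to\infty$, to a Poisson random variable with mean $\lambda$. -/

import Mathlib

open Filter Topology MeasureTheory ProbabilityTheory
open scoped NNReal

namespace FiniteGraph

/-! Graphs are Mathlib's multigraphs `Graph V E` (parallel edges and self-edges are allowed), and
they are finite because the types `V` and `E` are. -/

/-- `x` and `y` are connected by a path (possibly empty) all of whose edges belong to `S`. -/
def Joined {V E : Type*} (G : Graph V E) (S : Set E) (x y : V) : Prop :=
  Relation.ReflTransGen (fun a b => ∃ e ∈ S, G.IsLink e a b) x y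

/-- `G` is connected: every two of its vertices are joined by a path in `G`. -/
def IsConnected {V E : Type*} (G : Graph V E) : Prop :=
  G.vertexSet.Nonempty ∧ ∀ x ∈ G.vertexSet, ∀ y ∈ G.vertexSet, Joined G G.edgeSet x y

/-- `T` is the edge set of a spanning tree of `G`: any two vertices are joined within `T`, and `T`
contains no loop, that is, no edge of `T` (self-edges included) has its endpoints joined within
the rest of `T`. -/
structure IsSpanningTree {V E : Type*} (G : Graph V E) (T : Finset E) : Prop where
  subset : (T : Set E) ⊆ G.edgeSet
  spans : ∀ x ∈ G.vertexSet, ∀ y ∈ G.vertexSet, Joined G (T : Set E) x y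
  no_loop : ∀ e ∈ T, ∀ x y, G.IsLink e x y → ¬ Joined G ((T : Set E) \ {e}) x y

open Classical in
/-- The finite set of all spanning trees of `G`. -/
noncomputable def spanningTrees {V E : Type*} [Fintype E] (G : Graph V E) : Finset (Finset E) :=
  Finset.univ.filter fun T => IsSpanningTree G T

/-- `T` is a uniform random spanning tree of `G`, defined on the probability space `(Ω, P)`:
it equals each spanning tree with probability one over the number of spanning trees. -/
structure IsUniformSpanningTree {V E Ω : Type*} [Fintype E] [MeasurableSpace Ω]
    (G : Graph V E) (P : Measure Ω) (T : Ω → Finset E) : Prop where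
  measurable : ∀ S : Finset E, MeasurableSet (T ⁻¹' {S})
  law : ∀ S : Finset E, IsSpanningTree G S → P.real (T ⁻¹' {S}) = ((spanningTrees G).card : ℝ)⁻¹

open Classical in
/-- The degree of `v` in the set of edges `T` (self-edges are not counted; a tree has none). -/
noncomputable def degIn {V E : Type*} (G : Graph V E) (T : Finset E) (v : V) : ℕ :=
  (T.filter fun e => G.IsNonloopAt e v).card

/-- `deg_*`: the number of edges incident to `v` that are not self-edges. -/
noncomputable def degStar {V E : Type*} [Fintype E] (G : Graph V E) (v : V) : ℕ :=
  degIn G Finset.univ v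

open Classical in
/-- For edges `e` and `f` the sum of `1 / deg_* x` over the vertices `x ∈ e ∩ f`. -/
noncomputable def commonInvDeg {V E : Type*} [Fintype V] [Fintype E] (G : Graph V E)
    (e f : E) : ℝ :=
  ∑ x : V, if G.Inc e x ∧ G.Inc f x then (degStar G x : ℝ)⁻¹ else 0

open Classical in
/-- The sum of `1 / deg_* w` over the neighbors `w ≠ v` of `v`, where `w` is repeated once for
each edge that joins it to `v`. -/
noncomputable def neighborInvDeg {V E : Type*} [Fintype V] [Fintype E] (G : Graph V E)
    (v : V) : ℝ :=
  ∑ e : E, ∑ w : V, if w ≠ v ∧ G.IsLink e v w then (degStar G w : ℝ)⁻¹ else 0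

/-! ### Transfer impedance -/

open Classical in
/-- The net current that leaves `x` along the edges of `G`, each a one-ohm resistor, when the
voltages are `φ`. -/
noncomputable def outflow {V E : Type*} [Fintype V] [Fintype E] (G : Graph V E)
    (φ : V → ℝ) (x : V) : ℝ :=
  ∑ e : E, ∑ y : V, if G.IsLink e x y then φ x - φ y else 0

open Classical in
/-- `φ` is a voltage function for a unit current with source `x` and sink `y`. -/
def IsVoltage {V E : Type*} [Fintype V] [Fintype E] (G : Graph V E)
    (x y : V) (φ : V → ℝ) : Prop :=
  ∀ u, outflow G φ u = (if u = x then 1 else 0) - (if u = y then 1 else 0)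

/-- The transfer impedance `M(e, f)` of two oriented edges, `e` from `x` to `y` and `f` from `z` to
`w`: the voltage across `f` induced by a unit current with source `x` and sink `y`. In a connected
graph such a voltage function exists, and any of them gives the same value. -/
noncomputable def transferImpedance {V E : Type*} [Fintype V] [Fintype E] (G : Graph V E)
    (x y z w : V) : ℝ :=
  Classical.epsilon (IsVoltage G x y) z - Classical.epsilon (IsVoltage G x y) w

open Classical in
theorem sum_outflow_mul {V E : Type*} [Fintype V] [Fintype E] (G : Graph V E) (φ ψ : V → ℝ) :
    2 * ∑ x, ψ x * outflow G φ x = ∑ e : E, ∑ x : V, ∑ y : V,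
        if G.IsLink e x y then (φ x - φ y) * (ψ x - ψ y) else 0 := by
  have h1 : ∑ x, ψ x * outflow G φ x
      = ∑ e : E, ∑ x : V, ∑ y : V, if G.IsLink e x y then ψ x * (φ x - φ y) else 0 := by
    simp only [outflow, Finset.mul_sum, mul_ite, mul_zero]
    rw [Finset.sum_comm]
  have h2 : ∑ x, ψ x * outflow G φ x
      = ∑ e : E, ∑ x : V, ∑ y : V, if G.IsLink e x y then ψ y * (φ y - φ x) else 0 := by
    rw [h1]
    refine Finset.sum_congr rfl fun e _ => ?_
    rw [Finset.sum_comm]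
    refine Finset.sum_congr rfl fun x _ => Finset.sum_congr rfl fun y _ => ?_
    simp only [G.isLink_comm (x := y) (y := x)]
  rw [two_mul]
  nth_rewrite 1 [h1]
  rw [h2]
  simp only [← Finset.sum_add_distrib]
  refine Finset.sum_congr rfl fun e _ => Finset.sum_congr rfl fun x _ =>
    Finset.sum_congr rfl fun y _ => ?_
  split_ifs <;> ring

theorem eq_of_outflow_eq_zero {V E : Type*} [Fintype V] [Fintype E] {G : Graph V E}
    (hG : IsConnected G) {φ : V → ℝ} (h : ∀ u, outflow G φ u = 0) {z w : V}
    (hz : z ∈ G.vertexSet) (hw : w ∈ G.vertexSet) : φ z = φ w := by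
  classical
  have h0 := sum_outflow_mul G φ φ
  simp only [h, mul_zero, Finset.sum_const_zero] at h0
  have hnn : ∀ (e : E) (x y : V),
      0 ≤ if G.IsLink e x y then (φ x - φ y) * (φ x - φ y) else 0 := by
    intro e x y
    split_ifs
    · exact mul_self_nonneg _
    · exact le_rfl
  have key : ∀ e x y, G.IsLink e x y → φ x = φ y := by
    intro e x y hl
    have h1 := (Finset.sum_eq_zero_iff_of_nonneg (fun e _ => Finset.sum_nonneg fun x _ =>
      Finset.sum_nonneg fun y _ => hnn e x y)).1 h0.symm e (Finset.mem_univ _)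
    have h2 := (Finset.sum_eq_zero_iff_of_nonneg (fun x _ =>
      Finset.sum_nonneg fun y _ => hnn e x y)).1 h1 x (Finset.mem_univ _)
    have h3 := (Finset.sum_eq_zero_iff_of_nonneg (fun y _ => hnn e x y)).1 h2 y (Finset.mem_univ _)
    rw [if_pos hl] at h3
    exact sub_eq_zero.1 (mul_self_eq_zero.1 h3)
  have hj := hG.2 z hz w hw
  unfold Joined at hj
  induction hj with
  | refl => rfl
  | tail _ hbc ih =>
    obtain ⟨e, -, he⟩ := hbc
    exact (ih he.left_mem).trans (key e _ _ he)

theorem exists_isVoltage {V E : Type*} [Fintype V] [Fintype E] {G : Graph V E}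
    (hG : IsConnected G) {x y : V} (hx : x ∈ G.vertexSet) (hy : y ∈ G.vertexSet) :
    ∃ φ, IsVoltage G x y φ := by
  classical
  let L : EuclideanSpace ℝ V →ₗ[ℝ] EuclideanSpace ℝ V :=
    { toFun := fun φ => WithLp.toLp 2 (outflow G φ)
      map_add' := by
        intro φ ψ
        ext u
        simp only [outflow, PiLp.add_apply, ← Finset.sum_add_distrib]
        refine Finset.sum_congr rfl fun e _ => Finset.sum_congr rfl fun y _ => ?_
        split_ifs <;> ring
      map_smul' := by
        intro c φ
        ext u
        simp only [outflow, PiLp.smul_apply, smul_eq_mul, RingHom.id_apply, Finset.mul_sum]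
        refine Finset.sum_congr rfl fun e _ => Finset.sum_congr rfl fun y _ => ?_
        split_ifs <;> ring }
  have hL : ∀ φ u, L φ u = outflow G φ u := fun _ _ => rfl
  have hsymm : L.IsSymmetric := by
    intro φ ψ
    simp only [PiLp.inner_apply, hL, RCLike.inner_apply, conj_trivial]
    have h1 := sum_outflow_mul G φ ψ
    have h2 := sum_outflow_mul G ψ φ
    have h3 : ∑ u, outflow G ψ u * φ u = ∑ u, φ u * outflow G ψ u :=
      Finset.sum_congr rfl fun _ _ => mul_comm _ _
    rw [h3]
    have h4 : (2 : ℝ) * ∑ u, ψ u * outflow G φ u = 2 * ∑ u, φ u * outflow G ψ u := by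
      rw [h1, h2]
      refine Finset.sum_congr rfl fun e _ => Finset.sum_congr rfl fun x _ =>
        Finset.sum_congr rfl fun y _ => ?_
      split_ifs <;> ring
    linarith
  have hmem : (EuclideanSpace.single x (1 : ℝ) - EuclideanSpace.single y (1 : ℝ)) ∈
      LinearMap.range L := by
    rw [← Submodule.orthogonal_orthogonal (LinearMap.range L), hsymm.orthogonal_range,
      Submodule.mem_orthogonal]
    intro φ hφ
    have hφ0 : ∀ u, outflow G φ u = 0 := by
      intro u
      rw [← hL, LinearMap.mem_ker.1 hφ]
      rfl
    rw [inner_sub_right, EuclideanSpace.inner_single_right, EuclideanSpace.inner_single_right]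
    simp [eq_of_outflow_eq_zero hG hφ0 hx hy]
  obtain ⟨φ, hφ⟩ := hmem
  refine ⟨φ, fun u => ?_⟩
  rw [← hL, hφ]
  simp

/-- In a connected graph the transfer impedance can be computed from any voltage function. -/
theorem transferImpedance_eq {V E : Type*} [Fintype V] [Fintype E] {G : Graph V E}
    (hG : IsConnected G) {x y z w : V} (hx : x ∈ G.vertexSet) (hy : y ∈ G.vertexSet)
    (hz : z ∈ G.vertexSet) (hw : w ∈ G.vertexSet) {φ : V → ℝ} (hφ : IsVoltage G x y φ) :
    transferImpedance G x y z w = φ z - φ w := by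
  classical
  have hψ := Classical.epsilon_spec (exists_isVoltage hG hx hy)
  set ψ := Classical.epsilon (IsVoltage G x y) with hψdef
  have h0 : ∀ u, outflow G (fun v => ψ v - φ v) u = 0 := by
    intro u
    have h1 : outflow G (fun v => ψ v - φ v) u = outflow G ψ u - outflow G φ u := by
      simp only [outflow, ← Finset.sum_sub_distrib]
      refine Finset.sum_congr rfl fun e _ => Finset.sum_congr rfl fun y _ => ?_
      split_ifs <;> ring
    rw [h1, hψ u, hφ u, sub_self]
  have h2 := eq_of_outflow_eq_zero hG h0 hz hw
  unfold transferImpedance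
  rw [← hψdef]
  linarith

open Classical in
/-- One step of simple random walk on the graph obtained from `G` by adding self-edges until each
vertex has degree `D` (each self-edge counting once): `(A g) u` is the average of `g` over the
ends of the `D` edges at `u`. -/
noncomputable def walkStep {V E : Type*} [Fintype V] [Fintype E] (G : Graph V E) (D : ℝ)
    (g : V → ℝ) (u : V) : ℝ :=
  D⁻¹ * ((∑ e : E, ∑ y : V, if y ≠ u ∧ G.IsLink e u y then g y else 0)
    + (D - degStar G u) * g u)

theorem mul_sub_walkStep {V E : Type*} [Fintype V] [Fintype E] (G : Graph V E) {D : ℝ}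
    (hD : D ≠ 0) (g : V → ℝ) (u : V) : D * (g u - walkStep G D g u) = outflow G g u := by
  classical
  have hdeg : (degStar G u : ℝ) * g u
      = ∑ e : E, ∑ y : V, if y ≠ u ∧ G.IsLink e u y then g u else 0 := by
    rw [degStar, degIn, Finset.card_filter, Nat.cast_sum, Finset.sum_mul]
    refine Finset.sum_congr rfl fun e _ => ?_
    by_cases h : G.IsNonloopAt e u
    · obtain ⟨y, hy, hl⟩ := h
      have h' : G.IsNonloopAt e u := ⟨y, hy, hl⟩
      rw [Finset.sum_eq_single y]
      · simp [h', hy, hl]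
      · intro b _ hb
        rw [if_neg]
        rintro ⟨-, hb'⟩
        exact hb (hl.right_unique hb').symm
      · simp
    · rw [Finset.sum_eq_zero]
      · simp [h]
      · intro y _
        rw [if_neg]
        rintro ⟨hy, hl⟩
        exact h ⟨y, hy, hl⟩
  have hout : outflow G g u
      = (∑ e : E, ∑ y : V, if y ≠ u ∧ G.IsLink e u y then g u else 0)
        - ∑ e : E, ∑ y : V, if y ≠ u ∧ G.IsLink e u y then g y else 0 := by
    simp only [outflow, ← Finset.sum_sub_distrib]
    refine Finset.sum_congr rfl fun e _ => Finset.sum_congr rfl fun y _ => ?_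
    by_cases hy : y = u
    · subst hy; simp
    · by_cases hl : G.IsLink e u y <;> simp [hy, hl]
  rw [hout, ← hdeg, walkStep, mul_sub, mul_inv_cancel_left₀ hD]
  ring

/-- The transfer impedance through the Green's function `g` of the walk on the `D`-regular graph:
if `(I - A) g = δ_x - δ_y`, then `M(e, f) = (g z - g w) / D`, for every choice of `D`. -/
theorem transferImpedance_eq_green {V E : Type*} [Fintype V] [Fintype E] {G : Graph V E}
    (hG : IsConnected G) {x y z w : V} (hx : x ∈ G.vertexSet) (hy : y ∈ G.vertexSet)
    (hz : z ∈ G.vertexSet) (hw : w ∈ G.vertexSet) {D : ℝ} (hD : D ≠ 0) {g : V → ℝ}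
    (hg : ∀ u, g u - walkStep G D g u
      = (open Classical in (if u = x then 1 else 0) - (if u = y then 1 else 0))) :
    transferImpedance G x y z w = (g z - g w) / D := by
  classical
  have hv : IsVoltage G x y (fun u => D⁻¹ * g u) := by
    intro u
    have h1 : outflow G (fun u => D⁻¹ * g u) u = D⁻¹ * outflow G g u := by
      simp only [outflow, Finset.mul_sum]
      refine Finset.sum_congr rfl fun e _ => Finset.sum_congr rfl fun y _ => ?_
      split_ifs <;> ring
    rw [h1, ← mul_sub_walkStep G hD, inv_mul_cancel_left₀ hD]
    exact hg u
  rw [transferImpedance_eq hG hx hy hz hw hv]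
  field_simp

end FiniteGraph

/-!
The degree of `v` in a uniform spanning tree is distributed as a sum of independent Bernoulli
variables, one of which is constantly `1`, and a sum of independent Bernoulli variables with small
parameters is nearly Poisson.

The first fact comes from the weighted matrix-tree theorem `det_reducedLaplacian`. Give the edges at
`v` the weight `s` and all others the weight `1`. The spanning trees `T`, weighted in this way, sum
to `∑ T, s ^ deg_T v`, and this is the determinant of the Laplacian `L` grounded at `v`, to whose
diagonal `s - 1` is added once for each edge to `v`. With the incidence matrix `B` of the edges at
`v` the perturbation is `(s - 1) B Bᵀ`, and division by `det L` gives the generating function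
`det (1 + (s - 1) M)` of `deg v`, where `M = Bᵀ L⁻¹ B` (`sum_pow_degIn`). The entries of `M` are the
transfer impedances between the edges at `v` (`transferImpedance_eq_transferMatrix`), because `L⁻¹`
is the voltage grounded at `v`. The matrix-tree theorem itself is the multilinear expansion of the
determinant over the rows: the terms are the ways to choose an edge at each vertex other than `v`,
and a choice contributes `1` if it is a tree oriented towards `v` and `0` otherwise.

The matrix `M` is positive semidefinite. Its rows over the edges at `v` sum to `1`, since all the
current leaves `v` along these edges. So their indicator is an eigenvector with eigenvalue `1`, which
accounts for the factor `s`; removing it leaves `R = M - J / d`, where `d = deg_* v` and `J` is the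
all-ones matrix, and the eigenvalues `r i ≥ 0` of `R` are the parameters of the remaining Bernoulli
variables. The hypothesis says that `R e f` is close to `1 / deg_* w` if `e` and `f` both lead to `w`,
and to `0` if they have different ends. As the rows of `R` sum to `0`, the absolute row sums of `R`
are small, hence so are all `r i`, while the trace of `R` is close to `∑ w, 1 / deg_* w`
(`exists_bernoulli_parameters`). Thus the characteristic function of `deg v - 1` at `t`, which is
`∏ i, (1 + (s - 1) r i)` with `s = exp (i t)`, converges to `exp (λ (s - 1))`
(`norm_prod_sub_exp_le`), and Lévy's continuity theorem applies.
-/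

namespace FiniteGraph

/-! ### Spanning trees as arborescences -/

section Arborescence

variable {V E : Type*} {G : Graph V E} {v : V}

theorem Joined.symm {S : Set E} {x y : V} (h : Joined G S x y) : Joined G S y x := by
  induction h with
  | refl => exact .refl
  | tail _ hbc ih =>
    obtain ⟨e, he, hl⟩ := hbc
    exact ih.head ⟨e, he, hl.symm⟩

theorem Joined.mono {S S' : Set E} (hS : S ⊆ S') {x y : V} (h : Joined G S x y) :
    Joined G S' x y := by
  induction h with
  | refl => exact .refl
  | tail _ hbc ih =>
    obtain ⟨e, he, hl⟩ := hbc
    exact ih.tail ⟨e, hS he, hl⟩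

/-- The vertices of `G` other than the root `v`. -/
abbrev NonRoot (G : Graph V E) (v : V) : Type _ := {u : V // u ∈ G.vertexSet ∧ u ≠ v}

/-- `f` is an arborescence towards `v`: every vertex `a ≠ v` selects an edge `(f a).1`, which joins
it to its parent `(f a).2`, and the iterated parents never return to `a`. This last condition is
encoded by a height function that decreases from each vertex to its parent. -/
structure IsArborescence (G : Graph V E) (v : V) (f : NonRoot G v → E × V) : Prop where
  isLink : ∀ a, G.IsLink (f a).1 a (f a).2
  exists_height : ∃ h : V → ℕ, ∀ a, h (f a).2 < h a

open Classical in
/-- The set of all edges selected by `f`. -/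
noncomputable def selectedEdges [Fintype V] (f : NonRoot G v → E × V) : Finset E :=
  Finset.univ.image fun a => (f a).1

theorem mem_selectedEdges [Fintype V] {f : NonRoot G v → E × V} {e : E} :
    e ∈ selectedEdges f ↔ ∃ a, (f a).1 = e := by
  classical
  simp [selectedEdges]

theorem IsArborescence.injective {f : NonRoot G v → E × V} (hf : IsArborescence G v f) :
    Function.Injective fun a => (f a).1 := by
  obtain ⟨h, hh⟩ := hf.exists_height
  intro a b hab
  have ha := hf.isLink a
  have hb := hf.isLink b
  simp only at hab
  rw [← hab] at hb
  obtain ⟨h1, -⟩ | ⟨h1, h2⟩ := ha.eq_and_eq_or_eq_and_eq hb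
  · exact Subtype.ext h1
  · have h3 := hh a
    have h4 := hh b
    rw [h2] at h3
    rw [← h1] at h4
    exact absurd h3 h4.asymm

theorem IsArborescence.joined_root [Fintype V] {f : NonRoot G v → E × V}
    (hf : IsArborescence G v f) {u : V} (hu : u ∈ G.vertexSet) :
    Joined G (selectedEdges f : Set E) u v := by
  obtain ⟨h, hh⟩ := hf.exists_height
  induction hn : h u using Nat.strong_induction_on generalizing u with
  | _ n ih =>
    subst hn
    by_cases huv : u = v
    · subst huv
      exact Relation.ReflTransGen.refl
    · have hl := hf.isLink ⟨u, hu, huv⟩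
      exact Relation.ReflTransGen.head ⟨_, by simpa using mem_selectedEdges.2 ⟨_, rfl⟩, hl⟩
        (ih _ (hh ⟨u, hu, huv⟩) hl.right_mem rfl)

/-- There is no loop, because removing the edge selected by `w` separates the vertices with ancestor
`w` from all others. -/
theorem IsArborescence.isSpanningTree [Fintype V] {f : NonRoot G v → E × V}
    (hf : IsArborescence G v f) : IsSpanningTree G (selectedEdges f) where
  subset := by
    intro e he
    obtain ⟨a, rfl⟩ := mem_selectedEdges.1 he
    exact (hf.isLink a).edge_mem
  spans x hx y hy := (hf.joined_root hx).trans (hf.joined_root hy).symm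
  no_loop := by
    intro e he x y hxy hj
    obtain ⟨w, rfl⟩ := mem_selectedEdges.1 he
    obtain ⟨h, hh⟩ := hf.exists_height
    let parent : V → V → Prop := fun p q => ∃ a : NonRoot G v, p = a ∧ q = (f a).2
    have hle : ∀ {p q}, Relation.ReflTransGen parent p q → h q ≤ h p := by
      intro p q hpq
      induction hpq with
      | refl => exact le_rfl
      | tail _ hbc ih =>
        obtain ⟨a, rfl, rfl⟩ := hbc
        exact (hh a).le.trans ih
    have hstep : ∀ a : NonRoot G v, a ≠ w → (Relation.ReflTransGen parent a w ↔
        Relation.ReflTransGen parent (f a).2 w) := by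
      intro a haw
      refine ⟨fun hr => ?_, fun hr => hr.head ⟨a, rfl, rfl⟩⟩
      obtain heq | ⟨c, ⟨b, hb, rfl⟩, hc⟩ := hr.cases_head
      · exact absurd (Subtype.ext heq) haw
      · obtain rfl := Subtype.ext hb
        exact hc
    have hinv : ∀ {p q}, Joined G ((selectedEdges f : Set E) \ {(f w).1}) p q →
        (Relation.ReflTransGen parent p w ↔ Relation.ReflTransGen parent q w) := by
      intro p q hpq
      induction hpq with
      | refl => exact Iff.rfl
      | tail _ hbc ih =>
        obtain ⟨e', ⟨he', hne⟩, hl⟩ := hbc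
        obtain ⟨a, rfl⟩ := mem_selectedEdges.1 he'
        have haw : a ≠ w := by
          rintro rfl
          exact hne rfl
        rw [ih]
        obtain ⟨h1, h2⟩ | ⟨h1, h2⟩ := (hf.isLink a).eq_and_eq_or_eq_and_eq hl
        · rw [← h1, ← h2]
          exact hstep a haw
        · rw [← h1, ← h2]
          exact (hstep a haw).symm
    have hnot : ¬ Relation.ReflTransGen parent (f w).2 w := fun hr =>
      absurd (hle hr) (not_le.2 (hh w))
    obtain ⟨h1, h2⟩ | ⟨h1, h2⟩ := (hf.isLink w).eq_and_eq_or_eq_and_eq hxy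
    · rw [← h1, ← h2] at hj
      exact hnot ((hinv hj).1 .refl)
    · rw [← h1, ← h2] at hj
      exact hnot ((hinv hj).2 .refl)

/-- An arborescence is determined by its edges: where `f` and `g` differ at `a`, the edge of `a`
is selected under `g` by the parent of `a`, so that they already differ at that parent. -/
theorem IsArborescence.eq_of_selectedEdges_eq [Fintype V] {f g : NonRoot G v → E × V}
    (hf : IsArborescence G v f) (hg : IsArborescence G v g)
    (hfg : selectedEdges f = selectedEdges g) : f = g := by
  obtain ⟨h, hh⟩ := hf.exists_height
  have key : ∀ a, (f a).1 = (g a).1 := by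
    intro a
    induction hn : h a using Nat.strong_induction_on generalizing a with
    | _ n ih =>
      subst hn
      have hmem : (f a).1 ∈ selectedEdges g := hfg ▸ mem_selectedEdges.2 ⟨a, rfl⟩
      obtain ⟨b, hb⟩ := mem_selectedEdges.1 hmem
      have hlb := hg.isLink b
      rw [hb] at hlb
      obtain ⟨h1, -⟩ | ⟨-, h2⟩ := (hf.isLink a).eq_and_eq_or_eq_and_eq hlb
      · rw [← hb, Subtype.ext h1]
      · have hlt := hh a
        rw [h2] at hlt
        have h3 := ih _ hlt b rfl
        rw [hb] at h3
        have h4 := hf.injective h3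
        rw [h4] at hlt
        exact absurd hlt (lt_irrefl _)
  funext a
  refine Prod.ext (key a) ?_
  have h1 := hg.isLink a
  rw [← key a] at h1
  exact (hf.isLink a).right_unique h1

/-- The length of a shortest chain to `v` is a height function that some step decreases. -/
theorem exists_height_of_reflTransGen {α : Type*} (r : α → α → Prop) (v : α) :
    ∃ h : α → ℕ, ∀ u, Relation.ReflTransGen r u v → u ≠ v → ∃ y, r u y ∧ h y < h u := by
  let reach : ℕ → α → Prop := fun n => Nat.rec (· = v) (fun _ S u => ∃ y, r u y ∧ S y) n
  refine ⟨fun u => sInf {n | reach n u}, fun u hu huv => ?_⟩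
  have hne : {n | reach n u}.Nonempty := by
    clear huv
    induction hu using Relation.ReflTransGen.head_induction_on with
    | refl => exact ⟨0, rfl⟩
    | head hbc _ ih =>
      obtain ⟨n, hn⟩ := ih
      exact ⟨n + 1, _, hbc, hn⟩
  have hmem : reach (sInf {n | reach n u}) u := Nat.sInf_mem hne
  cases hn : sInf {n | reach n u} with
  | zero =>
    rw [hn] at hmem
    exact absurd hmem huv
  | succ m =>
    rw [hn] at hmem
    obtain ⟨y, hy, hm⟩ := hmem
    have hle : sInf {n | reach n y} ≤ m := Nat.sInf_le hm
    exact ⟨y, hy, (Nat.lt_succ_of_le hle).trans_eq hn.symm⟩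

theorem exists_isArborescence_of_joined {S : Set E}
    (hS : ∀ u ∈ G.vertexSet, Joined G S u v) :
    ∃ f : NonRoot G v → E × V, IsArborescence G v f ∧ ∀ a, (f a).1 ∈ S := by
  obtain ⟨h, hh⟩ := exists_height_of_reflTransGen (fun a b => ∃ e ∈ S, G.IsLink e a b) v
  have hex : ∀ a : NonRoot G v, ∃ p : E × V, p.1 ∈ S ∧ G.IsLink p.1 a p.2 ∧ h p.2 < h a := by
    intro a
    obtain ⟨y, ⟨e, he, hl⟩, hlt⟩ := hh a (hS a a.2.1) a.2.2
    exact ⟨(e, y), he, hl, hlt⟩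
  choose f hfS hfl hfh using hex
  exact ⟨f, ⟨hfl, h, hfh⟩, hfS⟩

theorem IsSpanningTree.exists_isArborescence [Fintype V] {T : Finset E} (hv : v ∈ G.vertexSet)
    (hT : IsSpanningTree G T) :
    ∃ f : NonRoot G v → E × V, IsArborescence G v f ∧ selectedEdges f = T := by
  obtain ⟨f, hf, hfT⟩ := exists_isArborescence_of_joined fun u hu => hT.spans u hu v hv
  refine ⟨f, hf, Finset.Subset.antisymm ?_ ?_⟩
  · intro e he
    obtain ⟨a, rfl⟩ := mem_selectedEdges.1 he
    exact hfT a
  · intro e he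
    by_contra hne
    obtain ⟨x, y, hl⟩ := G.exists_isLink_of_mem_edgeSet (hT.subset he)
    refine hT.no_loop e he x y hl
      ((hf.isSpanningTree.spans x hl.left_mem y hl.right_mem).mono ?_)
    intro e' he'
    obtain ⟨a, rfl⟩ := mem_selectedEdges.1 he'
    refine ⟨hfT a, ?_⟩
    rintro rfl
    exact hne he'

theorem spanningTrees_nonempty [Fintype V] [Fintype E] (hG : IsConnected G) :
    (spanningTrees G).Nonempty := by
  classical
  obtain ⟨v, hv⟩ := hG.1
  obtain ⟨f, hf, -⟩ := exists_isArborescence_of_joined fun u hu => hG.2 u hu v hv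
  exact ⟨selectedEdges f, Finset.mem_filter.2 ⟨Finset.mem_univ _, hf.isSpanningTree⟩⟩

end Arborescence

/-! ### The matrix-tree theorem -/

section MatrixTree

variable {V E K : Type*} [Fintype V] [Field K] {G : Graph V E} {v : V}

open Classical in
/-- The Laplacian of `G` with edge weights `wt`, with the row and the column of `v` deleted. -/
noncomputable def reducedLaplacian [Fintype E] (G : Graph V E) (v : V) (wt : E → K) :
    Matrix (NonRoot G v) (NonRoot G v) K :=
  fun a b => ∑ p : E × V, if G.IsLink p.1 a p.2 then
    wt p.1 * ((if a = b then 1 else 0) - (if p.2 = b then 1 else 0)) else 0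

open Classical in
/-- The matrix of `x ↦ (x a - x (parent a))`, where `x v = 0`. -/
noncomputable def parentMatrix (K : Type*) [Field K] {G : Graph V E} {v : V}
    (f : NonRoot G v → E × V) :
    Matrix (NonRoot G v) (NonRoot G v) K :=
  fun a b => (if a = b then 1 else 0) - (if (f a).2 = b then 1 else 0)

open Classical in
theorem det_parentMatrix_of_isArborescence {f : NonRoot G v → E × V}
    (hf : IsArborescence G v f) : (parentMatrix K f).det = 1 := by
  obtain ⟨h, hh⟩ := hf.exists_height
  have hdiag : ∀ a, parentMatrix K f a a = 1 := by
    intro a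
    have : (f a).2 ≠ a := fun heq => by
      have := hh a
      rw [heq] at this
      exact lt_irrefl _ this
    simp [parentMatrix, this]
  have hoff : ∀ a b : NonRoot G v, a ≠ b → h a ≤ h b → parentMatrix K f a b = 0 := by
    intro a b hab hle
    have : (f a).2 ≠ b := fun heq => by
      have := hh a
      rw [heq] at this
      exact absurd hle (not_le.2 this)
    simp [parentMatrix, this, hab]
  have hbt : (parentMatrix K f).BlockTriangular fun a : NonRoot G v => OrderDual.toDual (h a) := by
    intro a b hab
    have hlt : h a < h b := hab
    exact hoff a b (fun heq => by rw [heq] at hlt; exact lt_irrefl _ hlt) hlt.le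
  rw [hbt.det]
  refine Finset.prod_eq_one fun k _ => ?_
  have : (parentMatrix K f).toSquareBlock (fun a : NonRoot G v => OrderDual.toDual (h a)) k
      = 1 := by
    ext a b
    by_cases hab : a = b
    · subst hab
      simp [Matrix.toSquareBlock_def, hdiag]
    · rw [Matrix.one_apply_ne hab, Matrix.toSquareBlock_def]
      refine hoff a b (fun h' => hab (Subtype.ext h')) ?_
      have h1 : OrderDual.toDual (h a) = OrderDual.toDual (h b) := a.2.trans b.2.symm
      exact le_of_eq (OrderDual.toDual.injective h1)
  rw [this, Matrix.det_one]

open Classical in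
/-- If some iterated parents do not reach `v`, the indicator of the vertices from which `v` is not
reached lies in the kernel. -/
theorem det_parentMatrix_of_not_isArborescence {f : NonRoot G v → E × V}
    (hl : ∀ a, G.IsLink (f a).1 a (f a).2) (hf : ¬ IsArborescence G v f) :
    (parentMatrix K f).det = 0 := by
  let parent : V → V → Prop := fun p q => ∃ a : NonRoot G v, p = a ∧ q = (f a).2
  obtain ⟨h, hh⟩ := exists_height_of_reflTransGen parent v
  obtain ⟨w, hw⟩ : ∃ w : NonRoot G v, ¬ Relation.ReflTransGen parent w v := by
    by_contra! hall
    refine hf ⟨hl, h, fun a => ?_⟩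
    obtain ⟨y, ⟨b, hb, rfl⟩, hlt⟩ := hh a (hall a) a.2.2
    obtain rfl := Subtype.ext hb
    exact hlt
  refine Matrix.exists_mulVec_eq_zero_iff.1
    ⟨fun a => if Relation.ReflTransGen parent a v then 0 else 1, fun h0 => ?_, ?_⟩
  · have := congrFun h0 w
    simp [hw] at this
  · funext a
    have hiff : Relation.ReflTransGen parent a v ↔ Relation.ReflTransGen parent (f a).2 v := by
      refine ⟨fun hr => ?_, fun hr => hr.head ⟨a, rfl, rfl⟩⟩
      obtain heq | ⟨c, ⟨b, hb, rfl⟩, hc⟩ := hr.cases_head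
      · exact absurd heq a.2.2
      · obtain rfl := Subtype.ext hb
        exact hc
    simp only [Matrix.mulVec, dotProduct, parentMatrix, sub_mul, ite_mul, one_mul, zero_mul,
      Finset.sum_sub_distrib, Finset.sum_ite_eq, Finset.mem_univ, if_true, Pi.zero_apply]
    rw [sub_eq_zero]
    by_cases hv : (f a).2 = v
    · rw [Finset.sum_eq_zero, if_pos (hiff.2 (hv ▸ .refl))]
      intro b _
      rw [if_neg]
      rw [hv]
      exact fun h' => b.2.2 h'.symm
    · rw [Finset.sum_eq_single ⟨(f a).2, (hl a).right_mem, hv⟩]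
      · simp [hiff]
      · intro b _ hb
        rw [if_neg]
        exact fun h' => hb (Subtype.ext h'.symm)
      · simp

open Classical in
/-- The **weighted matrix-tree theorem**: each row of the reduced Laplacian is a sum over the edges
at a vertex, and the multilinear expansion of the determinant is a sum over all ways to select an
edge at each vertex, of which only the arborescences contribute. -/
theorem det_reducedLaplacian [Fintype E] (hv : v ∈ G.vertexSet) (wt : E → K) :
    (reducedLaplacian G v wt).det = ∑ T ∈ spanningTrees G, ∏ e ∈ T, wt e := by
  let c : (NonRoot G v → E × V) → NonRoot G v → K :=
    fun f a => if G.IsLink (f a).1 a (f a).2 then wt (f a).1 else 0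
  have h1 : (reducedLaplacian G v wt).det
      = ∑ f : NonRoot G v → E × V, (∏ a, c f a) * (parentMatrix K f).det := by
    have hrow : reducedLaplacian G v wt = fun a : NonRoot G v => ∑ p : E × V, fun b : NonRoot G v =>
        (if G.IsLink p.1 a p.2 then wt p.1 else 0)
          * ((if a = b then 1 else 0) - (if p.2 = b then 1 else 0)) := by
      funext a b
      rw [Finset.sum_apply]
      refine Finset.sum_congr rfl fun p _ => ?_
      split_ifs <;> simp
    rw [hrow]
    refine ((Matrix.detRowAlternating (n := NonRoot G v) (R := K)).toMultilinearMap.map_sum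
      fun (a : NonRoot G v) (p : E × V) (b : NonRoot G v) =>
        (if G.IsLink p.1 a p.2 then wt p.1 else 0)
          * ((if a = b then 1 else 0) - (if p.2 = b then 1 else 0))).trans ?_
    refine Finset.sum_congr rfl fun f _ => ?_
    have h2 := (Matrix.detRowAlternating (n := NonRoot G v) (R := K)).toMultilinearMap.map_smul_univ
      (c f) (parentMatrix K f)
    rw [smul_eq_mul] at h2
    exact h2
  have h2 : ∀ f : NonRoot G v → E × V, (∏ a, c f a) * (parentMatrix K f).det
      = if IsArborescence G v f then ∏ e ∈ selectedEdges f, wt e else 0 := by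
    intro f
    split_ifs with hf
    · rw [det_parentMatrix_of_isArborescence hf, mul_one, selectedEdges,
        Finset.prod_image fun a _ b _ h => hf.injective h]
      exact Finset.prod_congr rfl fun a _ => if_pos (hf.isLink a)
    · by_cases hl : ∀ a, G.IsLink (f a).1 a (f a).2
      · rw [det_parentMatrix_of_not_isArborescence hl hf, mul_zero]
      · push Not at hl
        obtain ⟨a, ha⟩ := hl
        rw [Finset.prod_eq_zero (Finset.mem_univ a) (if_neg ha), zero_mul]
  rw [h1, Finset.sum_congr rfl fun f _ => h2 f, ← Finset.sum_filter]
  refine Finset.sum_bij (fun f _ => selectedEdges f) ?_ ?_ ?_ ?_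
  · intro f hf
    exact Finset.mem_filter.2 ⟨Finset.mem_univ _, (Finset.mem_filter.1 hf).2.isSpanningTree⟩
  · intro f hf g hg hfg
    exact (Finset.mem_filter.1 hf).2.eq_of_selectedEdges_eq (Finset.mem_filter.1 hg).2 hfg
  · intro T hT
    obtain ⟨f, hf, hfT⟩ := (Finset.mem_filter.1 hT).2.exists_isArborescence hv
    exact ⟨f, Finset.mem_filter.2 ⟨Finset.mem_univ _, hf⟩, hfT⟩
  · intro f _
    rfl

end MatrixTree

/-! ### Determinants and eigenvalues of symmetric matrices -/

section LinearAlgebra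

variable {n : Type*} [Fintype n]

theorem det_one_add_smul_eq_prod_eigenvalues [DecidableEq n] {A : Matrix n n ℝ}
    (hA : A.IsHermitian) (z : ℝ) :
    (1 + z • A).det = ∏ i, (1 + z * hA.eigenvalues i) := by
  have h1 : 1 + z • A = Unitary.conjStarAlgAut ℝ _ hA.eigenvectorUnitary
      (Matrix.diagonal fun i => 1 + z * hA.eigenvalues i) := by
    have h2 : (Matrix.diagonal fun i => 1 + z * hA.eigenvalues i)
        = 1 + z • Matrix.diagonal (RCLike.ofReal ∘ hA.eigenvalues : n → ℝ) := by
      ext i j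
      by_cases hij : i = j
      · subst hij
        simp
      · simp [hij]
    conv_lhs => rw [hA.spectral_theorem]
    rw [h2, map_add, map_one, map_smul]
  rw [h1, Unitary.conjStarAlgAut_apply, Matrix.det_mul_comm, ← mul_assoc, Unitary.coe_star_mul_self,
    one_mul, Matrix.det_diagonal]

/-- The eigenvalues of a matrix are bounded by the largest row sum of absolute values: look at the
eigenvector equation in a coordinate where the eigenvector is largest. -/
theorem eigenvalues_le_of_sum_abs_le [DecidableEq n] {A : Matrix n n ℝ}
    (hA : A.IsHermitian) {δ : ℝ} (hδ : ∀ i, ∑ j, |A i j| ≤ δ) (k : n) : hA.eigenvalues k ≤ δ := by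
  set x : n → ℝ := ⇑(hA.eigenvectorBasis k) with hx
  have hev : A.mulVec x = hA.eigenvalues k • x := hA.mulVec_eigenvectorBasis k
  obtain ⟨i, -, hi⟩ := Finset.exists_max_image Finset.univ (fun i => |x i|) ⟨k, Finset.mem_univ k⟩
  have hxi : 0 < |x i| := by
    refine lt_of_le_of_ne (abs_nonneg _) fun h0 => ?_
    refine hA.eigenvectorBasis.toBasis.ne_zero k ?_
    rw [OrthonormalBasis.coe_toBasis]
    ext j
    have := hi j (Finset.mem_univ j)
    rw [← h0] at this
    exact abs_nonpos_iff.1 this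
  have h1 : hA.eigenvalues k * x i = ∑ j, A i j * x j := (congrFun hev i).symm
  have h2 : |hA.eigenvalues k| * |x i| ≤ δ * |x i| := by
    rw [← abs_mul, h1]
    calc |∑ j, A i j * x j| ≤ ∑ j, |A i j| * |x i| := by
          refine (Finset.abs_sum_le_sum_abs _ _).trans (Finset.sum_le_sum fun j _ => ?_)
          rw [abs_mul]
          exact mul_le_mul_of_nonneg_left (hi j (Finset.mem_univ j)) (abs_nonneg _)
      _ ≤ δ * |x i| := by
          rw [← Finset.sum_mul]
          exact mul_le_mul_of_nonneg_right (hδ i) (abs_nonneg _)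
  exact (le_abs_self _).trans (le_of_mul_le_mul_right h2 hxi)

/-- `M` with the eigenvalue `1` of its eigenvector `η` replaced by `0`. -/
noncomputable def deflate (M : Matrix n n ℝ) (η : n → ℝ) : Matrix n n ℝ :=
  M - (η ⬝ᵥ η)⁻¹ • Matrix.vecMulVec η η

variable {M : Matrix n n ℝ} {η : n → ℝ}

theorem deflate_mulVec (hMη : M.mulVec η = η) (h0 : η ⬝ᵥ η ≠ 0) :
    (deflate M η).mulVec η = 0 := by
  rw [deflate, Matrix.sub_mulVec, hMη, Matrix.smul_mulVec, Matrix.vecMulVec_mulVec]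
  simp [smul_smul, h0]

/-- With `J` the orthogonal projection to the span of `η`, `M - J = (1 - J) M (1 - J)`. -/
theorem posSemidef_deflate (hM : M.PosSemidef) (hMη : M.mulVec η = η) (h0 : η ⬝ᵥ η ≠ 0) :
    (deflate M η).PosSemidef := by
  classical
  set J : Matrix n n ℝ := (η ⬝ᵥ η)⁻¹ • Matrix.vecMulVec η η with hJ
  have hMJ : M * J = J := by
    rw [hJ, Matrix.mul_smul, Matrix.mul_vecMulVec, hMη]
  have hJt : J.conjTranspose = J := by
    ext i j
    simp [hJ, Matrix.vecMulVec_apply, mul_comm]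
  have hJM : J * M = J := by
    have := congrArg Matrix.conjTranspose hMJ
    rwa [Matrix.conjTranspose_mul, hJt, hM.1.eq] at this
  have hJJ : J * J = J := by
    rw [hJ, Matrix.smul_mul, Matrix.mul_smul, Matrix.vecMulVec_mul_vecMulVec]
    simp [smul_smul, Matrix.vecMulVec_smul, h0]
  have h := hM.conjTranspose_mul_mul_same (1 - J)
  rw [Matrix.conjTranspose_sub, hJt, Matrix.conjTranspose_one] at h
  have h1 : (1 - J) * M * (1 - J) = deflate M η := by
    rw [deflate, sub_mul, one_mul, hJM, mul_sub, mul_one, sub_mul, hMJ, hJJ, sub_self, sub_zero]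
  rwa [h1] at h

theorem det_one_add_smul_deflate [DecidableEq n] (hM : M.IsHermitian) (hMη : M.mulVec η = η)
    (h0 : η ⬝ᵥ η ≠ 0) (z : ℝ) : (1 + z • M).det = (1 + z) * (1 + z • deflate M η).det := by
  have hη : Matrix.vecMulVec η η * deflate M η = 0 := by
    have h1 : (deflate M η).transpose = deflate M η := by
      have h2 : M.transpose = M := by simpa using hM.eq
      rw [deflate, Matrix.transpose_sub, h2, Matrix.transpose_smul, Matrix.transpose_vecMulVec]
    rw [Matrix.vecMulVec_mul, ← h1, Matrix.vecMul_transpose, deflate_mulVec hMη h0]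
    simp
  have h1 : 1 + z • M
      = (1 + z • (η ⬝ᵥ η)⁻¹ • Matrix.vecMulVec η η) * (1 + z • deflate M η) := by
    rw [add_mul, one_mul, mul_add, mul_one, Matrix.mul_smul, Matrix.smul_mul, Matrix.smul_mul, hη,
      deflate]
    simp only [smul_zero, add_zero, smul_sub]
    abel
  rw [h1, Matrix.det_mul]
  congr 1
  have h2 : z • (η ⬝ᵥ η)⁻¹ • Matrix.vecMulVec η η
      = Matrix.replicateCol Unit ((z * (η ⬝ᵥ η)⁻¹) • η) * Matrix.replicateRow Unit η := by
    ext i j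
    simp [Matrix.mul_apply, Matrix.vecMulVec_apply, mul_assoc]
  rw [h2, Matrix.det_one_add_replicateCol_mul_replicateRow, dotProduct_smul, smul_eq_mul,
    mul_assoc, inv_mul_cancel₀ h0, mul_one]

end LinearAlgebra

/-! ### The transfer matrix of the edges at the root -/

section Transfer

variable {V E : Type*} {G : Graph V E} {v : V}

open Classical in
/-- The extension by `0` of a function on the vertices other than `v`. -/
noncomputable def extendZero (x : NonRoot G v → ℝ) (u : V) : ℝ :=
  if h : u ∈ G.vertexSet ∧ u ≠ v then x ⟨u, h⟩ else 0

theorem extendZero_coe (x : NonRoot G v → ℝ) (a : NonRoot G v) : extendZero x a = x a :=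
  dif_pos a.2

theorem extendZero_root (x : NonRoot G v → ℝ) : extendZero x v = 0 :=
  dif_neg fun h => h.2 rfl

open Classical in
/-- The incidence matrix between the vertices other than `v` and the edges at `v`. -/
noncomputable def rootIncidence (G : Graph V E) (v : V) : Matrix (NonRoot G v) E ℝ :=
  fun a e => if G.IsLink e v a then 1 else 0

open Classical in
/-- The indicator of the edges at `v` that are not self-edges. -/
noncomputable def rootIndicator (G : Graph V E) (v : V) (e : E) : ℝ :=
  if G.IsNonloopAt e v then 1 else 0

theorem rootIncidence_eq_zero {e : E} (he : ¬ G.IsNonloopAt e v) (a : NonRoot G v) :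
    rootIncidence G v a e = 0 :=
  if_neg fun hl => he ⟨a, a.2.2, hl⟩

open Classical in
theorem rootIncidence_of_isLink {e : E} {y : NonRoot G v} (hl : G.IsLink e v y)
    (a : NonRoot G v) : rootIncidence G v a e = if a = y then 1 else 0 := by
  rw [rootIncidence]
  congr 1
  exact propext ⟨fun h => Subtype.ext (h.right_unique hl), fun h => h ▸ hl⟩

theorem exists_nonRoot {e : E} (he : G.IsNonloopAt e v) : ∃ y : NonRoot G v, G.IsLink e v y := by
  obtain ⟨y, hy, hl⟩ := he
  exact ⟨⟨y, hl.right_mem, hy⟩, hl⟩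

variable [Fintype V] [Fintype E]

open Classical in
theorem outflow_extendZero (x : NonRoot G v → ℝ) (a : NonRoot G v) :
    outflow G (extendZero x) a = ((reducedLaplacian G v (1 : E → ℝ)).mulVec x) a := by
  simp only [Matrix.mulVec, dotProduct, reducedLaplacian, Finset.sum_mul]
  rw [Finset.sum_comm, Fintype.sum_prod_type, outflow]
  refine Finset.sum_congr rfl fun e _ => Finset.sum_congr rfl fun y _ => ?_
  by_cases hl : G.IsLink e a y
  · simp only [hl, if_true, Pi.one_apply, one_mul, sub_mul, ite_mul, zero_mul,
      Finset.sum_sub_distrib, Finset.sum_ite_eq, Finset.mem_univ, extendZero_coe]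
    congr 1
    by_cases hy : y = v
    · rw [hy, extendZero_root, Finset.sum_eq_zero]
      intro b _
      exact if_neg fun h => b.2.2 h.symm
    · rw [Finset.sum_eq_single ⟨y, hl.right_mem, hy⟩]
      · rw [if_pos rfl]
        exact extendZero_coe x ⟨y, hl.right_mem, hy⟩
      · intro b _ hb
        exact if_neg fun h => hb (Subtype.ext h.symm)
      · simp
  · simp [hl]

theorem sum_outflow_eq_zero (φ : V → ℝ) : ∑ u, outflow G φ u = 0 := by
  classical
  have h := sum_outflow_mul G φ 1
  simp only [Pi.one_apply, one_mul, sub_self, mul_zero, ite_self, Finset.sum_const_zero] at h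
  linarith

theorem outflow_of_notMem (φ : V → ℝ) {u : V} (hu : u ∉ G.vertexSet) : outflow G φ u = 0 := by
  classical
  refine Finset.sum_eq_zero fun e _ => Finset.sum_eq_zero fun y _ => ?_
  exact if_neg fun hl => hu hl.left_mem

theorem posSemidef_reducedLaplacian : (reducedLaplacian G v (1 : E → ℝ)).PosSemidef := by
  classical
  refine Matrix.posSemidef_iff_dotProduct_mulVec.2 ⟨?_, fun x => ?_⟩
  · ext a b
    rw [Matrix.conjTranspose_apply, star_trivial]
    by_cases hab : a = b
    · rw [hab]
    · have h : ∀ a b : NonRoot G v, a ≠ b → reducedLaplacian G v (1 : E → ℝ) a b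
          = ∑ e : E, if G.IsLink e a b then -1 else 0 := by
        intro a b hab
        rw [reducedLaplacian, Fintype.sum_prod_type]
        refine Finset.sum_congr rfl fun e _ => ?_
        rw [Finset.sum_eq_single (b : V)]
        · simp [hab]
        · intro y _ hy
          simp [hab, hy]
        · simp
      rw [h a b hab, h b a (Ne.symm hab)]
      exact Finset.sum_congr rfl fun e _ => by rw [G.isLink_comm]
  · have h1 : star x ⬝ᵥ (reducedLaplacian G v (1 : E → ℝ)).mulVec x
        = ∑ u, extendZero x u * outflow G (extendZero x) u := by
      rw [dotProduct]
      simp only [star_trivial]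
      rw [← Finset.sum_subset (Finset.subset_univ (Finset.univ.filter
        fun u => u ∈ G.vertexSet ∧ u ≠ v)), Finset.sum_subtype (p := fun u =>
        u ∈ G.vertexSet ∧ u ≠ v) _ (by simp)]
      · exact Finset.sum_congr rfl fun a _ => by
          rw [extendZero_coe, outflow_extendZero]
      · intro u _ hu
        rw [extendZero, dif_neg fun h => hu (Finset.mem_filter.2 ⟨Finset.mem_univ _, h⟩), zero_mul]
    have h2 := sum_outflow_mul G (extendZero x) (extendZero x)
    rw [h1]
    have h3 : 0 ≤ ∑ e : E, ∑ p : V, ∑ y : V, if G.IsLink e p y then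
        (extendZero x p - extendZero x y) * (extendZero x p - extendZero x y) else 0 := by
      refine Finset.sum_nonneg fun e _ => Finset.sum_nonneg fun p _ =>
        Finset.sum_nonneg fun y _ => ?_
      split_ifs
      · exact mul_self_nonneg _
      · exact le_rfl
    linarith

open Classical in
theorem isUnit_det_reducedLaplacian (hG : IsConnected G) (hv : v ∈ G.vertexSet) :
    IsUnit (reducedLaplacian G v (1 : E → ℝ)).det := by
  rw [det_reducedLaplacian hv, isUnit_iff_ne_zero]
  simp [(spanningTrees_nonempty hG).ne_empty]

open Classical in
/-- The matrix of the transfer impedances between edges at `v`, oriented away from `v`, and `0` for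
all other edges. The inverse of the reduced Laplacian is the voltage function grounded at `v`. -/
noncomputable def transferMatrix (G : Graph V E) (v : V) : Matrix E E ℝ :=
  (rootIncidence G v).transpose * (reducedLaplacian G v (1 : E → ℝ))⁻¹ * rootIncidence G v

open Classical in
theorem transferMatrix_apply {e f : E} {y w : NonRoot G v} (he : G.IsLink e v y)
    (hf : G.IsLink f v w) :
    transferMatrix G v e f = (reducedLaplacian G v (1 : E → ℝ))⁻¹ y w := by
  simp [transferMatrix, Matrix.mul_apply, rootIncidence_of_isLink he, rootIncidence_of_isLink hf]

theorem transferMatrix_eq_zero_left {e : E} (he : ¬ G.IsNonloopAt e v) (f : E) :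
    transferMatrix G v e f = 0 := by
  simp [transferMatrix, Matrix.mul_apply, rootIncidence_eq_zero he]

theorem posSemidef_transferMatrix : (transferMatrix G v).PosSemidef := by
  classical
  have h := (posSemidef_reducedLaplacian (G := G) (v := v)).inv.conjTranspose_mul_mul_same
    (rootIncidence G v)
  rwa [Matrix.conjTranspose_eq_transpose_of_trivial] at h

theorem transferMatrix_comm (e f : E) : transferMatrix G v e f = transferMatrix G v f e := by
  have h := posSemidef_transferMatrix (G := G) (v := v).1.apply f e
  simpa using h

theorem transferMatrix_eq_zero_right {f : E} (hf : ¬ G.IsNonloopAt f v) (e : E) :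
    transferMatrix G v e f = 0 := by
  rw [transferMatrix_comm, transferMatrix_eq_zero_left hf]

/-- All the current leaves `v` along the edges at `v`. -/
theorem transferMatrix_mulVec_rootIndicator (hG : IsConnected G) (hv : v ∈ G.vertexSet) :
    (transferMatrix G v).mulVec (rootIndicator G v) = rootIndicator G v := by
  classical
  have h1 : (rootIncidence G v).mulVec (rootIndicator G v)
      = (reducedLaplacian G v (1 : E → ℝ)).mulVec 1 := by
    funext a
    rw [← outflow_extendZero, outflow, Matrix.mulVec, dotProduct]
    refine Finset.sum_congr rfl fun e _ => ?_
    have h2 : ∀ y : V, (if G.IsLink e a y then extendZero (1 : NonRoot G v → ℝ) a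
        - extendZero (1 : NonRoot G v → ℝ) y else 0) = if y = v then rootIncidence G v a e else 0 := by
      intro y
      by_cases hy : y = v
      · rw [if_pos hy, hy, extendZero_root, extendZero_coe, G.isLink_comm, rootIncidence]
        simp
      · rw [if_neg hy]
        split_ifs with hl
        · rw [extendZero_coe, extendZero, dif_pos ⟨hl.right_mem, hy⟩]
          simp
        · rfl
    rw [Finset.sum_congr rfl fun y _ => h2 y, Finset.sum_ite_eq' , if_pos (Finset.mem_univ _)]
    by_cases he : G.IsNonloopAt e v
    · simp [rootIndicator, he]
    · simp [rootIncidence_eq_zero he]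
  have h3 : (rootIncidence G v).transpose.mulVec 1 = rootIndicator G v := by
    funext e
    rw [Matrix.mulVec, dotProduct, rootIndicator]
    by_cases he : G.IsNonloopAt e v
    · obtain ⟨y, hl⟩ := exists_nonRoot he
      simp [rootIncidence_of_isLink hl, he]
    · simp [rootIncidence_eq_zero he, he]
  rw [transferMatrix, ← Matrix.mulVec_mulVec, h1, ← Matrix.mulVec_mulVec,
    Matrix.mulVec_mulVec (1 : NonRoot G v → ℝ),
    Matrix.nonsing_inv_mul _ (isUnit_det_reducedLaplacian hG hv), Matrix.one_mulVec, h3]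

theorem transferImpedance_eq_transferMatrix (hG : IsConnected G) (hv : v ∈ G.vertexSet) {e f : E}
    {y w : NonRoot G v} (he : G.IsLink e v y) (hf : G.IsLink f v w) :
    transferImpedance G v y v w = transferMatrix G v e f := by
  classical
  set x : NonRoot G v → ℝ := fun a => -(reducedLaplacian G v (1 : E → ℝ))⁻¹ a y with hx
  have hLx : (reducedLaplacian G v (1 : E → ℝ)).mulVec x = -Pi.single y 1 := by
    have h1 : x = -((reducedLaplacian G v (1 : E → ℝ))⁻¹).mulVec (Pi.single y 1) := by
      funext a
      simp [hx]
    rw [h1, Matrix.mulVec_neg, Matrix.mulVec_mulVec,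
      Matrix.mul_nonsing_inv _ (isUnit_det_reducedLaplacian hG hv), Matrix.one_mulVec]
  have hout : ∀ u, u ≠ v → outflow G (extendZero x) u = -(if u = y then 1 else 0) := by
    intro u hu
    by_cases hmem : u ∈ G.vertexSet
    · have h2 := outflow_extendZero x ⟨u, hmem, hu⟩
      rw [hLx] at h2
      rw [h2, Pi.neg_apply, Pi.single_apply]
      simp [Subtype.ext_iff]
    · rw [outflow_of_notMem _ hmem, if_neg, neg_zero]
      rintro rfl
      exact hmem y.2.1
  have hvolt : IsVoltage G v y (extendZero x) := by
    intro u
    by_cases hu : u = v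
    · have h3 := sum_outflow_eq_zero (G := G) (extendZero x)
      rw [← Finset.add_sum_erase _ _ (Finset.mem_univ v), Finset.sum_congr rfl fun u hu =>
        hout u (Finset.ne_of_mem_erase hu), Finset.sum_neg_distrib, Finset.sum_ite_eq',
        if_pos (Finset.mem_erase.2 ⟨y.2.2, Finset.mem_univ _⟩)] at h3
      rw [hu, if_pos rfl, if_neg (Ne.symm y.2.2)]
      linarith
    · rw [hout u hu, if_neg hu, zero_sub]
  rw [transferImpedance_eq hG hv y.2.1 hv w.2.1 hvolt, extendZero_root, extendZero_coe,
    transferMatrix_comm, transferMatrix_apply hf he]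
  simp [hx]

open Classical in
/-- Changing the weights of the edges at `v` changes only the diagonal of the Laplacian. -/
theorem reducedLaplacian_rootWeight (s : ℝ) :
    reducedLaplacian G v (fun e => if G.IsNonloopAt e v then s else 1)
      = reducedLaplacian G v 1
        + (s - 1) • (rootIncidence G v * (rootIncidence G v).transpose) := by
  ext a b
  rw [Matrix.add_apply, Matrix.smul_apply, Matrix.mul_apply, smul_eq_mul, Finset.mul_sum,
    reducedLaplacian, reducedLaplacian, Fintype.sum_prod_type, Fintype.sum_prod_type,
    ← Finset.sum_add_distrib]
  refine Finset.sum_congr rfl fun e _ => ?_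
  simp only [Matrix.transpose_apply, Pi.one_apply]
  by_cases he : G.IsNonloopAt e v
  · obtain ⟨w, hw⟩ := exists_nonRoot he
    simp only [he, if_true]
    rw [rootIncidence_of_isLink hw, rootIncidence_of_isLink hw]
    by_cases haw : a = w
    · subst haw
      have hl : ∀ y, G.IsLink e a y ↔ y = v := fun y =>
        ⟨fun h => h.right_unique hw.symm, fun h => h ▸ hw.symm⟩
      have hvb : v ≠ b := fun h => b.2.2 h.symm
      simp only [hl, Finset.sum_ite_eq', Finset.mem_univ, if_true, hvb, if_false, @eq_comm _ b a]
      split_ifs <;> ring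
    · have hl : ∀ y, ¬ G.IsLink e a y := fun y h => by
        rcases h.left_eq_or_eq hw with h' | h'
        · exact a.2.2 h'
        · exact haw (Subtype.ext h')
      simp [hl, haw]
  · simp [he, rootIncidence_eq_zero he]

/-- The generating function of the degree of `v` in a uniform spanning tree, from the matrix-tree
theorem with weight `s` on the edges at `v`. -/
theorem sum_pow_degIn (hG : IsConnected G) (hv : v ∈ G.vertexSet) [DecidableEq E] (s : ℝ) :
    ∑ T ∈ spanningTrees G, s ^ degIn G T v
      = (spanningTrees G).card * (1 + (s - 1) • transferMatrix G v).det := by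
  classical
  have hunit := isUnit_det_reducedLaplacian (E := E) hG hv
  have h1 : ((spanningTrees G).card : ℝ) = (reducedLaplacian G v (1 : E → ℝ)).det := by
    rw [det_reducedLaplacian hv]
    simp
  have h2 : ∑ T ∈ spanningTrees G, s ^ degIn G T v
      = (reducedLaplacian G v (fun e => if G.IsNonloopAt e v then s else 1)).det := by
    rw [det_reducedLaplacian hv]
    refine Finset.sum_congr rfl fun T _ => ?_
    rw [Finset.prod_ite, Finset.prod_const, Finset.prod_const_one, mul_one, degIn]
  set L := reducedLaplacian G v (1 : E → ℝ) with hL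
  set B := rootIncidence G v with hB
  have h3 : L + (s - 1) • (B * B.transpose) = L * (1 + (L⁻¹ * B) * ((s - 1) • B.transpose)) := by
    rw [mul_add, mul_one, Matrix.mul_smul, Matrix.mul_smul, Matrix.mul_assoc L⁻¹,
      ← Matrix.mul_assoc L, Matrix.mul_nonsing_inv _ hunit, Matrix.one_mul]
  rw [h2, reducedLaplacian_rootWeight, h1, ← hL, ← hB, h3, Matrix.det_mul,
    Matrix.det_one_add_mul_comm, Matrix.smul_mul, ← Matrix.mul_assoc]
  rfl

end Transfer

/-! ### The degree of the root as a sum of independent indicators -/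

section Bernoulli

variable {V E : Type*} [Fintype E] {G : Graph V E} {v : V}

theorem rootIndicator_dotProduct_self :
    rootIndicator G v ⬝ᵥ rootIndicator G v = (degStar G v : ℝ) := by
  classical
  simp [dotProduct, rootIndicator, degStar, degIn, ← ite_and]

/-- An identity of polynomials in `s`, checked for real `s`, holds for complex `s`. -/
theorem sum_pow_degIn_complex {r : E → ℝ}
    (hr : ∀ s : ℝ, ∑ T ∈ spanningTrees G, s ^ degIn G T v
        = (spanningTrees G).card * (s * ∏ i, (1 + (s - 1) * r i))) (s : ℂ) :
    ∑ T ∈ spanningTrees G, s ^ degIn G T v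
        = (spanningTrees G).card * (s * ∏ i, (1 + (s - 1) * (r i : ℂ))) := by
  have h : (∑ T ∈ spanningTrees G, (Polynomial.X : Polynomial ℝ) ^ degIn G T v)
      = ((spanningTrees G).card : Polynomial ℝ) * (Polynomial.X
        * ∏ i, (1 + (Polynomial.X - 1) * Polynomial.C (r i))) := by
    refine Polynomial.funext fun t => ?_
    simpa [Polynomial.eval_finsetSum, Polynomial.eval_prod] using hr t
  simpa [map_sum, map_prod] using congrArg (Polynomial.aeval s) h

variable [Fintype V]

open Classical in
/-- The part of `commonInvDeg` that comes from common endpoints other than `v`. -/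
noncomputable def commonNeighborInvDeg (G : Graph V E) (v : V) (e f : E) : ℝ :=
  ∑ w : V, if w ≠ v ∧ G.IsLink e v w ∧ G.IsLink f v w then (degStar G w : ℝ)⁻¹ else 0

theorem commonNeighborInvDeg_nonneg (e f : E) : 0 ≤ commonNeighborInvDeg G v e f := by
  classical
  refine Finset.sum_nonneg fun w _ => ?_
  split_ifs
  · positivity
  · exact le_rfl

theorem commonNeighborInvDeg_comm (e f : E) :
    commonNeighborInvDeg G v e f = commonNeighborInvDeg G v f e := by
  classical
  refine Finset.sum_congr rfl fun w _ => ?_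
  simp only [and_comm (a := G.IsLink e v w)]

theorem commonNeighborInvDeg_eq_zero {e : E} (he : ¬ G.IsNonloopAt e v) (f : E) :
    commonNeighborInvDeg G v e f = 0 := by
  classical
  exact Finset.sum_eq_zero fun w _ => if_neg fun h => he ⟨w, h.1, h.2.1⟩

theorem sum_commonNeighborInvDeg_self :
    ∑ e, commonNeighborInvDeg G v e e = neighborInvDeg G v := by
  classical
  refine Finset.sum_congr rfl fun e _ => Finset.sum_congr rfl fun w _ => ?_
  simp only [and_self]

theorem commonInvDeg_eq {e f : E} {y w : NonRoot G v} (he : G.IsLink e v y)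
    (hf : G.IsLink f v w) :
    commonInvDeg G e f = (degStar G v : ℝ)⁻¹ + commonNeighborInvDeg G v e f := by
  classical
  rw [commonInvDeg, commonNeighborInvDeg, ← Finset.add_sum_erase _ _ (Finset.mem_univ v),
    if_pos ⟨he.inc_left, hf.inc_left⟩]
  congr 1
  rw [← Finset.add_sum_erase Finset.univ _ (Finset.mem_univ v), if_neg (fun h => h.1 rfl), zero_add]
  refine Finset.sum_congr rfl fun u hu => ?_
  have huv := Finset.ne_of_mem_erase hu
  congr 1
  refine propext ⟨fun h => ⟨huv, ?_, ?_⟩, fun h => ⟨h.2.1.inc_right, h.2.2.inc_right⟩⟩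
  · rwa [h.1.eq_of_isLink_of_ne_left he huv]
  · rwa [h.2.eq_of_isLink_of_ne_left hf huv]

/-- The transfer matrix without its eigenvalue `1`, which accounts for the fact that the tree has at
least one edge at `v`. -/
noncomputable def reducedTransferMatrix (G : Graph V E) (v : V) : Matrix E E ℝ :=
  deflate (transferMatrix G v) (rootIndicator G v)

theorem reducedTransferMatrix_apply (e f : E) : reducedTransferMatrix G v e f
    = transferMatrix G v e f - (degStar G v : ℝ)⁻¹ * (rootIndicator G v e * rootIndicator G v f) := by
  rw [reducedTransferMatrix, deflate, rootIndicator_dotProduct_self]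
  rfl

theorem posSemidef_reducedTransferMatrix (hG : IsConnected G) (hv : v ∈ G.vertexSet)
    (hd : degStar G v ≠ 0) : (reducedTransferMatrix G v).PosSemidef :=
  posSemidef_deflate posSemidef_transferMatrix (transferMatrix_mulVec_rootIndicator hG hv)
    (by rw [rootIndicator_dotProduct_self]; exact_mod_cast hd)

theorem sum_reducedTransferMatrix (hG : IsConnected G) (hv : v ∈ G.vertexSet)
    (hd : degStar G v ≠ 0) (e : E) : ∑ f, reducedTransferMatrix G v e f = 0 := by
  have h := congrFun (deflate_mulVec (transferMatrix_mulVec_rootIndicator hG hv)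
    (by rw [rootIndicator_dotProduct_self]; exact_mod_cast hd)) e
  rw [Pi.zero_apply, Matrix.mulVec, dotProduct] at h
  rw [← h]
  refine Finset.sum_congr rfl fun f _ => ?_
  change reducedTransferMatrix G v e f = reducedTransferMatrix G v e f * _
  by_cases hf : G.IsNonloopAt f v
  · rw [rootIndicator, if_pos hf, mul_one]
  · rw [reducedTransferMatrix_apply, transferMatrix_eq_zero_right hf, rootIndicator,
      rootIndicator, if_neg hf]
    ring

/-- The reduced transfer matrix is close to the contribution of the common neighbors, because the
term `1 / deg_* v` has been removed. The symmetry of the transfer matrix is used to express the error through the second edge, so that it is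
summable over that edge. -/
theorem abs_reducedTransferMatrix_sub_le (hG : IsConnected G) (hv : v ∈ G.vertexSet) {κ : ℝ}
    (hκ : 0 ≤ κ)
    (hM : ∀ e f : E, ∀ y w : V, y ≠ v → w ≠ v → G.IsLink e v y → G.IsLink f v w →
      |transferImpedance G v y v w - commonInvDeg G e f| ≤ κ * commonInvDeg G e e) (e f : E) :
    |reducedTransferMatrix G v e f - commonNeighborInvDeg G v e f|
      ≤ κ * ((degStar G v : ℝ)⁻¹ * rootIndicator G v f + commonNeighborInvDeg G v f f) := by
  classical
  have hnn : 0 ≤ κ * ((degStar G v : ℝ)⁻¹ * rootIndicator G v f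
      + commonNeighborInvDeg G v f f) := by
    have h1 := commonNeighborInvDeg_nonneg (G := G) (v := v) f f
    have h2 : 0 ≤ rootIndicator G v f := by
      rw [rootIndicator]
      split_ifs <;> norm_num
    positivity
  rw [reducedTransferMatrix_apply]
  by_cases he : G.IsNonloopAt e v
  · by_cases hf : G.IsNonloopAt f v
    · obtain ⟨y, hy⟩ := exists_nonRoot he
      obtain ⟨w, hw⟩ := exists_nonRoot hf
      have h := hM f e w y w.2.2 y.2.2 hw hy
      rw [transferImpedance_eq_transferMatrix hG hv hw hy, commonInvDeg_eq hw hy,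
        commonInvDeg_eq hw hw, transferMatrix_comm, commonNeighborInvDeg_comm] at h
      rw [rootIndicator, rootIndicator, if_pos he, if_pos hf, mul_one, mul_one, sub_sub]
      exact h
    · rw [transferMatrix_eq_zero_right hf, commonNeighborInvDeg_comm,
        commonNeighborInvDeg_eq_zero hf]
      refine le_trans (le_of_eq ?_) hnn
      simp [rootIndicator, hf]
  · rw [transferMatrix_eq_zero_left he, commonNeighborInvDeg_eq_zero he]
    refine le_trans (le_of_eq ?_) hnn
    simp [rootIndicator, he]

/-- One less than the degree of `v` is distributed as a sum of independent Bernoulli variables with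
small parameters `r`, the eigenvalues of the reduced transfer matrix: the last clause expresses this
through generating functions. -/
theorem exists_bernoulli_parameters (hG : IsConnected G) (hv : v ∈ G.vertexSet)
    (hd : degStar G v ≠ 0) {κ : ℝ} (hκ : 0 ≤ κ)
    (hM : ∀ e f : E, ∀ y w : V, y ≠ v → w ≠ v → G.IsLink e v y → G.IsLink f v w →
      |transferImpedance G v y v w - commonInvDeg G e f| ≤ κ * commonInvDeg G e e) :
    ∃ r : E → ℝ, (∀ i, 0 ≤ r i) ∧ (∀ i, r i ≤ 2 * (κ * (1 + neighborInvDeg G v))) ∧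
      |∑ i, r i - neighborInvDeg G v| ≤ κ * (1 + neighborInvDeg G v) ∧
      ∀ s : ℝ, ∑ T ∈ spanningTrees G, s ^ degIn G T v
        = (spanningTrees G).card * (s * ∏ i, (1 + (s - 1) * r i)) := by
  classical
  have hpsd := posSemidef_reducedTransferMatrix hG hv hd
  have hd' : (degStar G v : ℝ) ≠ 0 := by exact_mod_cast hd
  have herr := abs_reducedTransferMatrix_sub_le hG hv hκ hM
  have hsum : ∑ f, κ * ((degStar G v : ℝ)⁻¹ * rootIndicator G v f
      + commonNeighborInvDeg G v f f) = κ * (1 + neighborInvDeg G v) := by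
    have h1 : ∑ f, rootIndicator G v f = (degStar G v : ℝ) := by
      simp [rootIndicator, degStar, degIn]
    rw [← Finset.mul_sum, Finset.sum_add_distrib, ← Finset.mul_sum, h1,
      sum_commonNeighborInvDeg_self, inv_mul_cancel₀ hd']
  have herr_sum : ∀ e, ∑ f, |reducedTransferMatrix G v e f - commonNeighborInvDeg G v e f|
      ≤ κ * (1 + neighborInvDeg G v) := fun e =>
    (Finset.sum_le_sum fun f _ => herr e f).trans_eq hsum
  -- The rows of the reduced transfer matrix sum to zero, so that few edges are parallel.
  have hcommon : ∀ e, ∑ f, commonNeighborInvDeg G v e f ≤ κ * (1 + neighborInvDeg G v) := by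
    intro e
    have h1 : ∑ f, commonNeighborInvDeg G v e f
        = -∑ f, (reducedTransferMatrix G v e f - commonNeighborInvDeg G v e f) := by
      rw [Finset.sum_sub_distrib, sum_reducedTransferMatrix hG hv hd]
      ring
    rw [h1]
    exact (neg_le_abs _).trans ((Finset.abs_sum_le_sum_abs _ _).trans (herr_sum e))
  have hrow : ∀ e, ∑ f, |reducedTransferMatrix G v e f| ≤ 2 * (κ * (1 + neighborInvDeg G v)) := by
    intro e
    have h1 : ∀ f, |reducedTransferMatrix G v e f|
        ≤ |reducedTransferMatrix G v e f - commonNeighborInvDeg G v e f|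
          + commonNeighborInvDeg G v e f := by
      intro f
      have h2 := abs_add_le (reducedTransferMatrix G v e f - commonNeighborInvDeg G v e f)
        (commonNeighborInvDeg G v e f)
      rwa [sub_add_cancel, abs_of_nonneg (commonNeighborInvDeg_nonneg e f)] at h2
    have h3 := Finset.sum_le_sum fun f (_ : f ∈ Finset.univ) => h1 f
    rw [Finset.sum_add_distrib] at h3
    linarith [herr_sum e, hcommon e]
  refine ⟨hpsd.1.eigenvalues, hpsd.eigenvalues_nonneg,
    eigenvalues_le_of_sum_abs_le hpsd.1 hrow, ?_, fun s => ?_⟩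
  · have h1 : ∑ i, hpsd.1.eigenvalues i = ∑ e, reducedTransferMatrix G v e e := by
      simpa [Matrix.trace] using hpsd.1.trace_eq_sum_eigenvalues.symm
    rw [h1, ← sum_commonNeighborInvDeg_self, ← Finset.sum_sub_distrib,
      sum_commonNeighborInvDeg_self, ← hsum]
    exact (Finset.abs_sum_le_sum_abs _ _).trans (Finset.sum_le_sum fun e _ => herr e e)
  · rw [sum_pow_degIn hG hv, det_one_add_smul_deflate posSemidef_transferMatrix.1
      (transferMatrix_mulVec_rootIndicator hG hv)
      (by rw [rootIndicator_dotProduct_self]; exact hd'), add_sub_cancel]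
    congr 2
    exact det_one_add_smul_eq_prod_eigenvalues hpsd.1 _

end Bernoulli

/-! ### Convergence to the Poisson distribution -/

section Limit

theorem norm_prod_sub_prod_le {ι : Type*} (t : Finset ι) (a b : ι → ℂ) (ha : ∀ i, ‖a i‖ ≤ 1)
    (hb : ∀ i, ‖b i‖ ≤ 1) : ‖∏ i ∈ t, a i - ∏ i ∈ t, b i‖ ≤ ∑ i ∈ t, ‖a i - b i‖ := by
  classical
  induction t using Finset.induction_on with
  | empty => simp
  | insert j t hj ih =>
    rw [Finset.prod_insert hj, Finset.prod_insert hj, Finset.sum_insert hj]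
    have h1 : a j * ∏ i ∈ t, a i - b j * ∏ i ∈ t, b i
        = (a j - b j) * ∏ i ∈ t, a i + b j * (∏ i ∈ t, a i - ∏ i ∈ t, b i) := by ring
    have h2 : ‖∏ i ∈ t, a i‖ ≤ 1 := by
      rw [norm_prod]
      exact Finset.prod_le_one (fun i _ => norm_nonneg _) fun i _ => ha i
    rw [h1]
    refine (norm_add_le _ _).trans ?_
    rw [norm_mul, norm_mul]
    exact add_le_add (mul_le_of_le_one_right (norm_nonneg _) h2)
      ((mul_le_of_le_one_left (norm_nonneg _) (hb j)).trans ih)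

/-- The generating function of a sum of independent Bernoulli variables is close to that of a
Poisson variable with the same mean. -/
theorem norm_prod_sub_exp_le {ι : Type*} [Fintype ι] {r : ι → ℝ} {δ : ℝ} (hδ : δ ≤ 1 / 2)
    (h0 : ∀ i, 0 ≤ r i) (h1 : ∀ i, r i ≤ δ) {s : ℂ} (hs : ‖s‖ ≤ 1) :
    ‖∏ i, (1 + (s - 1) * (r i : ℂ)) - Complex.exp ((s - 1) * ((∑ i, r i : ℝ) : ℂ))‖
      ≤ 4 * (δ * ∑ i, r i) := by
  have hs2 : ‖s - 1‖ ≤ 2 := (norm_sub_le _ _).trans (by rw [norm_one]; linarith)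
  have hz : ∀ i, ‖(s - 1) * (r i : ℂ)‖ ≤ 2 * r i := fun i => by
    rw [norm_mul, Complex.norm_real, Real.norm_of_nonneg (h0 i)]
    exact mul_le_mul_of_nonneg_right hs2 (h0 i)
  have h2 : Complex.exp ((s - 1) * ((∑ i, r i : ℝ) : ℂ))
      = ∏ i, Complex.exp ((s - 1) * (r i : ℂ)) := by
    rw [← Complex.exp_sum, Complex.ofReal_sum, Finset.mul_sum]
  have ha : ∀ i, ‖1 + (s - 1) * (r i : ℂ)‖ ≤ 1 := by
    intro i
    have h3 : 1 + (s - 1) * (r i : ℂ) = ((1 - r i : ℝ) : ℂ) + s * (r i : ℂ) := by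
      push_cast
      ring
    rw [h3]
    refine (norm_add_le _ _).trans ?_
    rw [norm_mul, Complex.norm_real, Complex.norm_real, Real.norm_of_nonneg (h0 i),
      Real.norm_of_nonneg (by linarith [h1 i])]
    nlinarith [mul_le_mul_of_nonneg_right hs (h0 i)]
  have hb : ∀ i, ‖Complex.exp ((s - 1) * (r i : ℂ))‖ ≤ 1 := by
    intro i
    rw [Complex.norm_exp, Complex.re_mul_ofReal, Complex.sub_re, Complex.one_re]
    refine Real.exp_le_one_iff.2 (mul_nonpos_of_nonpos_of_nonneg ?_ (h0 i))
    linarith [(Complex.re_le_norm s).trans hs]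
  rw [h2]
  refine (norm_prod_sub_prod_le _ _ _ ha hb).trans ?_
  rw [← mul_assoc, Finset.mul_sum]
  refine Finset.sum_le_sum fun i _ => ?_
  rw [norm_sub_rev, ← sub_sub]
  refine (Complex.norm_exp_sub_one_sub_id_le ((hz i).trans (by linarith [h1 i]))).trans ?_
  calc ‖(s - 1) * (r i : ℂ)‖ ^ 2 ≤ (2 * r i) ^ 2 :=
        pow_le_pow_left₀ (norm_nonneg _) (hz i) 2
    _ ≤ 4 * δ * r i := by nlinarith [mul_le_mul_of_nonneg_right (h1 i) (h0 i)]

end Limit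

section RandomTree

variable {V E Ω : Type*} [Fintype E] [MeasurableSpace Ω] {G : Graph V E} {v : V}
  {P : Measure Ω} {T : Ω → Finset E}

theorem IsUniformSpanningTree.measurable_comp {β : Type*} [MeasurableSpace β]
    (hT : IsUniformSpanningTree G P T) (g : Finset E → β) : Measurable fun ω => g (T ω) := by
  intro s _
  have h1 : (fun ω => g (T ω)) ⁻¹' s = ⋃ S ∈ {S : Finset E | g S ∈ s}, T ⁻¹' {S} := by
    ext ω
    simp
  rw [h1]
  exact MeasurableSet.biUnion (Set.to_countable _) fun S _ => hT.measurable S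

/-- The law determines all expectations, since it has total mass one on the spanning trees. -/
theorem IsUniformSpanningTree.integral_comp [Fintype V] [IsProbabilityMeasure P]
    (hG : IsConnected G) (hT : IsUniformSpanningTree G P T) (g : Finset E → ℂ) :
    ∫ ω, g (T ω) ∂P = ((spanningTrees G).card : ℂ)⁻¹ * ∑ S ∈ spanningTrees G, g S := by
  classical
  let _ : MeasurableSpace (Finset E) := ⊤
  have : DiscreteMeasurableSpace (Finset E) := ⟨fun _ => trivial⟩
  have hmeas : Measurable T := hT.measurable_comp id
  have hcard : ((spanningTrees G).card : ℝ) ≠ 0 :=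
    Nat.cast_ne_zero.2 (Finset.card_ne_zero.2 (spanningTrees_nonempty hG))
  have := Measure.isProbabilityMeasure_map (μ := P) hmeas.aemeasurable
  have hreal : ∀ S, (P.map T).real {S} = P.real (T ⁻¹' {S}) := fun S =>
    map_measureReal_apply hmeas (MeasurableSet.singleton S)
  have htree : ∀ S ∈ spanningTrees G, (P.map T).real {S} = ((spanningTrees G).card : ℝ)⁻¹ :=
    fun S hS => (hreal S).trans (hT.law S (Finset.mem_filter.1 hS).2)
  have htotal : ∑ S, (P.map T).real {S} = 1 := by
    rw [sum_measureReal_singleton]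
    simp
  have hzero : ∀ S ∉ spanningTrees G, (P.map T).real {S} = 0 := by
    have h1 := Finset.sum_add_sum_compl (spanningTrees G) fun S => (P.map T).real {S}
    rw [htotal, Finset.sum_congr rfl htree, Finset.sum_const, nsmul_eq_mul,
      mul_inv_cancel₀ hcard] at h1
    intro S hS
    refine (Finset.sum_eq_zero_iff_of_nonneg fun S _ => measureReal_nonneg).1
      (add_eq_left.1 h1) S (Finset.mem_compl.2 hS)
  rw [← integral_map (f := g) hmeas.aemeasurable
    (Measurable.of_discrete).aestronglyMeasurable, integral_fintype .of_finite, Finset.mul_sum,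
    ← Finset.sum_subset (Finset.subset_univ (spanningTrees G))]
  · refine Finset.sum_congr rfl fun S hS => ?_
    rw [htree S hS, Complex.real_smul]
    push_cast
    rfl
  · intro S _ hS
    rw [hzero S hS, zero_smul]

end RandomTree

end FiniteGraph

open FiniteGraph in
theorem theorem5p1
    {V E Ω : ℕ → Type*} [∀ k, Fintype (V k)] [∀ k, Fintype (E k)]
    (G : ∀ k, Graph (V k) (E k)) (hG : ∀ k, FiniteGraph.IsConnected (G k))
    (v : ∀ k, V k) (hv : ∀ k, v k ∈ (G k).vertexSet)
    [∀ k, MeasurableSpace (Ω k)] (P : ∀ k, Measure (Ω k)) [∀ k, IsProbabilityMeasure (P k)]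
    (T : ∀ k, Ω k → Finset (E k))
    (hT : ∀ k, FiniteGraph.IsUniformSpanningTree (G k) (P k) (T k))
    (ε : ℕ → ℝ) (hε_pos : ∀ k, 0 < ε k) (hε : Tendsto ε atTop (𝓝 0))
    (hM : ∃ C : ℝ, ∀ k, ∀ e f : E k, ∀ y w : V k, y ≠ v k → w ≠ v k →
      (G k).IsLink e (v k) y → (G k).IsLink f (v k) w →
      |FiniteGraph.transferImpedance (G k) (v k) y (v k) w
          - FiniteGraph.commonInvDeg (G k) e f|
        ≤ C * ε k * FiniteGraph.commonInvDeg (G k) e e)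
    (lam : ℝ≥0) (hlam : 0 < lam)
    (hsum : Tendsto (fun k => FiniteGraph.neighborInvDeg (G k) (v k)) atTop (𝓝 (lam : ℝ))) :
    TendstoInDistribution
      (fun k ω => (FiniteGraph.degIn (G k) (T k ω) (v k) : ℝ) - 1) atTop
      (fun n : ℕ => (n : ℝ)) P (poissonMeasure lam) := by
  have hmeas : ∀ k, Measurable fun ω => (degIn (G k) (T k ω) (v k) : ℝ) - 1 := fun k =>
    (hT k).measurable_comp fun S => (degIn (G k) S (v k) : ℝ) - 1
  refine ⟨fun k => (hmeas k).aemeasurable, Measurable.of_discrete.aemeasurable, ?_⟩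
  refine ProbabilityMeasure.tendsto_iff_tendsto_charFun.2 fun t => ?_
  simp only [ProbabilityMeasure.coe_mk, charFun_map_cast_poissonMeasure]
  obtain ⟨C, hC⟩ := hM
  set s : ℂ := Complex.exp (t * Complex.I) with hs
  have hs1 : ‖s‖ = 1 := Complex.norm_exp_ofReal_mul_I t
  have hs0 : s ≠ 0 := Complex.exp_ne_zero _
  have hκ : ∀ k, 0 ≤ |C| * ε k := fun k => mul_nonneg (abs_nonneg _) (hε_pos k).le
  have hM' : ∀ k, ∀ e f : E k, ∀ y w : V k, y ≠ v k → w ≠ v k →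
      (G k).IsLink e (v k) y → (G k).IsLink f (v k) w →
      |transferImpedance (G k) (v k) y (v k) w - commonInvDeg (G k) e f|
        ≤ |C| * ε k * commonInvDeg (G k) e e := by
    classical
    intro k e f y w hy hw he hf
    refine (hC k e f y w hy hw he hf).trans (mul_le_mul_of_nonneg_right
      (mul_le_mul_of_nonneg_right (le_abs_self C) (hε_pos k).le)
      (Finset.sum_nonneg fun x _ => ?_))
    split_ifs
    · positivity
    · exact le_rfl
  -- An isolated `v k` has no neighbors, which is impossible for large `k` because `lam > 0`.
  have hd : ∀ᶠ k in atTop, degStar (G k) (v k) ≠ 0 := by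
    filter_upwards [hsum.eventually_ne (NNReal.coe_ne_zero.2 hlam.ne')] with k hk hzero
    refine hk ?_
    classical
    rw [degStar, degIn, Finset.card_eq_zero, Finset.filter_eq_empty_iff] at hzero
    rw [← sum_commonNeighborInvDeg_self]
    exact Finset.sum_eq_zero fun e he => commonNeighborInvDeg_eq_zero (hzero he) e
  choose! r hr0 hrδ hrsum hrgen using fun k (h : degStar (G k) (v k) ≠ 0) =>
    exists_bernoulli_parameters (hG k) (hv k) h (hκ k) (hM' k)
  have hδ : Tendsto (fun k => |C| * ε k * (1 + neighborInvDeg (G k) (v k))) atTop (𝓝 0) := by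
    simpa using (hε.const_mul |C|).mul (hsum.const_add 1)
  have hsumr : Tendsto (fun k => ∑ i, r k i) atTop (𝓝 (lam : ℝ)) := by
    have h1 : Tendsto (fun k => ∑ i, r k i - neighborInvDeg (G k) (v k)) atTop (𝓝 0) :=
      squeeze_zero_norm' (hd.mono fun k hk => hrsum k hk) hδ
    simpa using h1.add hsum
  have hchar : ∀ᶠ k in atTop, ∏ i, (1 + (s - 1) * (r k i : ℂ))
      = charFun ((P k).map fun ω => (degIn (G k) (T k ω) (v k) : ℝ) - 1) t := by
    filter_upwards [hd] with k hk
    rw [charFun_apply, integral_map (hmeas k).aemeasurable (by fun_prop)]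
    have h1 : ∀ ω, Complex.exp (inner ℝ ((degIn (G k) (T k ω) (v k) : ℝ) - 1) t * Complex.I)
        = s⁻¹ * s ^ degIn (G k) (T k ω) (v k) := by
      intro ω
      rw [hs, ← Complex.exp_neg, ← Complex.exp_nat_mul, ← Complex.exp_add, Real.inner_apply]
      congr 1
      push_cast
      ring
    have hcard : ((spanningTrees (G k)).card : ℂ) ≠ 0 :=
      Nat.cast_ne_zero.2 (Finset.card_ne_zero.2 (spanningTrees_nonempty (hG k)))
    rw [integral_congr_ae (ae_of_all _ h1), (hT k).integral_comp (hG k)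
      fun S => s⁻¹ * s ^ degIn (G k) S (v k), ← Finset.mul_sum,
      sum_pow_degIn_complex (hrgen k hk)]
    field_simp
  refine Tendsto.congr' hchar ?_
  have hexp : Tendsto (fun k => Complex.exp ((s - 1) * ((∑ i, r k i : ℝ) : ℂ))) atTop
      (𝓝 (Complex.exp (lam * (s - 1)))) := by
    have h1 : Tendsto (fun k => ((∑ i, r k i : ℝ) : ℂ)) atTop (𝓝 ((lam : ℝ) : ℂ)) :=
      (Complex.continuous_ofReal.tendsto _).comp hsumr
    rw [mul_comm (lam : ℂ)]
    exact (Complex.continuous_exp.tendsto _).comp (h1.const_mul (s - 1))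
  have hdiff : Tendsto (fun k => ∏ i, (1 + (s - 1) * (r k i : ℂ))
      - Complex.exp ((s - 1) * ((∑ i, r k i : ℝ) : ℂ))) atTop (𝓝 0) := by
    have h2 := (hδ.const_mul 2)
    rw [mul_zero] at h2
    refine squeeze_zero_norm' ?_ (by simpa using (h2.mul hsumr).const_mul 4)
    filter_upwards [hd, h2.eventually_le_const (by norm_num : (0 : ℝ) < 1 / 2)] with k hk hk2
    exact norm_prod_sub_exp_le hk2 (hr0 k hk) (hrδ k hk) hs1.le
  simpa using hdiff.add hexp
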